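/- Let $(\Omega,\mathcal F,\mathbb P)$ be a probability space, let $d_1,d_2:\mathbb N\to\mathbb N$ be functions, and for every $d\in\mathbb N$ let $A_d\in M_{d_1(d)}(\mathbb C)\otimes M_{d_2(d)}(\mathbb C)$ be a random Hermitian matrix on $\Omega$ (Hermitian almost surely). No assumption is made on the joint law of the matrices $A_d$ for different $d$. Assume that 1. $d_1(d)\to\infty$ and $d_2(d)\to\infty$ as $d\to\infty$, in such a way that $d_1(d)/d_2(d)^2\to 0$ and $\sum_d d_2(d)^{-4}<\infty$ (the sum being over those $d$ with $d_2(d)\neq 0$); 2. each $A_d$ is unitarily invariant: for every unitary matrix $U\in\mathcal U(d_1(d)d_2(d))$, the random matrices $UA_dU^*$ and $A_d$ have the same law; 3. the family $(A_d)$ has almost surely limit distribution $\mu$, for some compactly supported probability measure $\mu$ on $\mathbb R$, i.e. for every integer $p\ge 1$, almost surely $$\lim_{d\to\infty}\frac{1}{d_1(d)d_2(d)}\operatorname{Tr}(A_d^p)=\int x^p\,d\mu(x).$$ Then the normalized partial traces $B_d:=d_2(d)^{-1}[\operatorname{id}\otimes\operatorname{Tr}](A_d)\in M_{d_1(d)}(\mathbb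 C)$ converge almost surely in operator norm to a multiple of the identity: almost surely, $$\lim_{d\to\infty}\|B_d-a\,I_{d_1(d)}\|=0,\qquad\text{where } a:=\int x\,d\mu(x).$$ -/

import Mathlib

open MeasureTheory Filter Topology
open scoped Matrix.Norms.L2Operator

/-- Matrices carry the product `σ`-algebra of their entries. -/
instance instMeasurableSpaceMatrix {m n α : Type*} [MeasurableSpace α] :
    MeasurableSpace (Matrix m n α) :=
  inferInstanceAs (MeasurableSpace (m → n → α))

/-- The partial trace `id ⊗ Tr` over the second tensor factor, where the algebra
`M_m(R) ⊗ M_n(R)` is identified, through the Kronecker product, with the matrices whose rows and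
columns are indexed by `m × n`. -/
def partialTraceSnd {m n R : Type*} [Fintype n] [AddCommMonoid R]
    (M : Matrix (m × n) (m × n) R) : Matrix m m R :=
  Matrix.of fun i j => ∑ k, M (i, k) (j, k)

/-- The normalized trace `tr X = Tr X / N` of an `N × N` complex matrix. -/
noncomputable def normalizedTrace {n : Type*} [Fintype n] (X : Matrix n n ℂ) : ℂ :=
  X.trace / (Fintype.card n : ℂ)

/-- The law of the random matrix `X` is invariant under conjugation by every unitary matrix. -/
def IsUnitarilyInvariant {Ω n : Type*} [MeasurableSpace Ω] [Fintype n] [DecidableEq n]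
    (P : Measure Ω) (X : Ω → Matrix n n ℂ) : Prop :=
  ∀ U ∈ Matrix.unitaryGroup n ℂ,
    P.map (fun ω => U * X ω * star U) = P.map X

/-- The sequence `X` of random matrices has almost surely limit distribution `μ`: all the
normalized moments converge almost surely to the moments of `μ`. -/
def HasAlmostSureLimitDistribution {Ω : Type*} [MeasurableSpace Ω] {n : ℕ → Type*}
    [∀ d, Fintype (n d)] [∀ d, DecidableEq (n d)]
    (P : Measure Ω) (X : ∀ d, Ω → Matrix (n d) (n d) ℂ) (μ : Measure ℝ) : Prop :=
  ∀ p : ℕ, 1 ≤ p → ∀ᵐ ω ∂P,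
    Tendsto (fun d => normalizedTrace (X d ω ^ p)) atTop (𝓝 ((∫ x, x ^ p ∂μ : ℝ) : ℂ))

/-! ### Hilbert-Schmidt and operator norms. -/

section HilbertSchmidt

variable {m n l : Type*} [Fintype m] [Fintype n] [Fintype l]

/-! Write `m = d₁`, `n = d₂`, `N = m n`, let `Φ` be the conditional expectation onto the first
tensor factor and `q = ‖Φ(A) - tr A‖²` in Hilbert-Schmidt norm. Since `Φ(A) - tr A = D ⊗ 1` with `D
= B - tr A`, one has `n ‖D‖² ≤ q`. As `tr A` tends to the first moment of `μ`, it suffices that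
almost surely `q = o(n)`.

The tail of `q` is controlled by a loop (Schwinger-Dyson) equation. Unitary invariance makes the
mean of any `C¹` function constant along conjugation by `exp (tY)`, so its derivative in the
direction `YA - AY` has mean zero. For the entries of `A Φ(A) h(q)`, with `Y` running over the
matrix units, the sum of these identities has main term `N q h(q)`. The errors are at most `(m/n)
Tr(A²) h(q)` and `4 ‖A‖² q h'(q)`, the latter from a commutator of `A` with `Φ(A)`.

With `h = (q - c)₊ ^ (k + 2)` this becomes a recursion in `k` that gains a factor of order `‖A‖² /
N` at each step (`integral_posPart_pow_succ_le`). Bounded second and sixth moments give `q ≤ Tr(A²)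
= O(N)` and `‖A‖⁶ ≤ Tr(A⁶) = O(N)`. Three steps thus cost `‖A‖⁶ / N³ = O(N⁻²)`, which exactly
absorbs the `O(N²)` of the initial integral, so `c⁵ P(q ≥ 2c) = O(1)`. Taking `c = n ε` is allowed
because `m / n² → 0`, and Borel-Cantelli concludes because `∑ n⁻⁴ < ∞`. -/

theorem re_trace_conjTranspose_mul_self (X : Matrix m n ℂ) :
    (X.conjTranspose * X).trace.re = ∑ j, ∑ i, ‖X i j‖ ^ 2 := by
  simp only [Matrix.trace, Matrix.diag_apply, Matrix.mul_apply, Matrix.conjTranspose_apply,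
    Complex.re_sum]
  refine Finset.sum_congr rfl fun j _ => Finset.sum_congr rfl fun i _ => ?_
  rw [← Complex.normSq_eq_norm_sq, Complex.star_def, ← Complex.normSq_eq_conj_mul_self,
    Complex.ofReal_re]

theorem re_trace_conjTranspose_mul_self_nonneg (X : Matrix m n ℂ) :
    0 ≤ (X.conjTranspose * X).trace.re := by
  rw [re_trace_conjTranspose_mul_self]
  positivity

theorem re_trace_mul_self_nonneg {X : Matrix n n ℂ} (hX : X.IsHermitian) :
    0 ≤ (X * X).trace.re := by
  simpa only [hX.eq] using re_trace_conjTranspose_mul_self_nonneg X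

theorem Matrix.IsHermitian.im_trace {A : Matrix n n ℂ} (hA : A.IsHermitian) :
    A.trace.im = 0 := by
  have h := Matrix.trace_conjTranspose A
  rw [hA.eq, Complex.star_def] at h
  exact Complex.conj_eq_iff_im.1 h.symm

variable [DecidableEq n]

theorem sum_norm_sq_mulVec_le (A : Matrix m n ℂ) (v : n → ℂ) :
    ∑ i, ‖A.mulVec v i‖ ^ 2 ≤ ‖A‖ ^ 2 * ∑ j, ‖v j‖ ^ 2 := by
  have h := A.l2_opNorm_mulVec (WithLp.toLp 2 v)
  have h2 := pow_le_pow_left₀ (norm_nonneg _) h 2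
  rw [mul_pow, EuclideanSpace.norm_sq_eq, EuclideanSpace.norm_sq_eq] at h2
  simpa using h2

theorem re_trace_conjTranspose_mul_self_mul_le (A : Matrix m n ℂ) (X : Matrix n l ℂ) :
    ((A * X).conjTranspose * (A * X)).trace.re
      ≤ ‖A‖ ^ 2 * (X.conjTranspose * X).trace.re := by
  rw [re_trace_conjTranspose_mul_self, re_trace_conjTranspose_mul_self, Finset.mul_sum]
  exact Finset.sum_le_sum fun j _ => sum_norm_sq_mulVec_le A fun i => X i j

theorem norm_sq_le_re_trace_conjTranspose_mul_self (A : Matrix m n ℂ) :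
    ‖A‖ ^ 2 ≤ (A.conjTranspose * A).trace.re := by
  set s := (A.conjTranspose * A).trace.re with hs
  have hs0 : 0 ≤ s := re_trace_conjTranspose_mul_self_nonneg A
  rw [re_trace_conjTranspose_mul_self, Finset.sum_comm] at hs
  refine (Real.le_sqrt (norm_nonneg _) hs0).1 ?_
  rw [Matrix.l2_opNorm_def]
  refine ContinuousLinearMap.opNorm_le_bound _ (Real.sqrt_nonneg _) fun v => ?_
  refine (sq_le_sq₀ (norm_nonneg _) (by positivity)).1 ?_
  rw [mul_pow, Real.sq_sqrt hs0, EuclideanSpace.norm_sq_eq, EuclideanSpace.norm_sq_eq, hs,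
    Finset.sum_mul]
  refine Finset.sum_le_sum fun i _ => ?_
  have h1 : ‖∑ j, A i j * v j‖ ≤ ∑ j, ‖A i j‖ * ‖v j‖ :=
    (norm_sum_le _ _).trans_eq (by simp)
  exact (pow_le_pow_left₀ (norm_nonneg _) h1 2).trans (Finset.sum_mul_sq_le_sq_mul_sq _ _ _)

/-- The sixth moment is the one needed: the recursion below is iterated three times, each step
costing a squared norm. Two uses of the C*-identity give `‖A⁴‖ = ‖A‖⁴`, hence the cube bound, and
the operator norm of `A³` is at most its Hilbert-Schmidt norm. -/
theorem Matrix.IsHermitian.norm_pow_six_le {A : Matrix n n ℂ} (hA : A.IsHermitian) :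
    ‖A‖ ^ 6 ≤ (A ^ 6).trace.re := by
  have h4 : ‖A ^ 4‖ = ‖A‖ ^ 4 := by
    have h (X : Matrix n n ℂ) (hX : X.IsHermitian) : ‖X ^ 2‖ = ‖X‖ ^ 2 := by
      rw [sq, sq, ← Matrix.l2_opNorm_conjTranspose_mul_self, hX.eq]
    rw [show A ^ 4 = (A ^ 2) ^ 2 by rw [← pow_mul], h _ (hA.pow 2), h _ hA]
    ring
  have h3 : ‖A‖ ^ 3 ≤ ‖A ^ 3‖ := by
    rcases (norm_nonneg A).eq_or_lt with h0 | h0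
    · rw [← h0]; simp
    · refine le_of_mul_le_mul_left ?_ h0
      calc ‖A‖ * ‖A‖ ^ 3 = ‖A ^ 4‖ := by rw [h4]; ring
        _ = ‖A * A ^ 3‖ := by rw [← pow_succ']
        _ ≤ ‖A‖ * ‖A ^ 3‖ := Matrix.l2_opNorm_mul _ _
  calc ‖A‖ ^ 6 = (‖A‖ ^ 3) ^ 2 := by ring
    _ ≤ ‖A ^ 3‖ ^ 2 := by gcongr
    _ ≤ ((A ^ 3).conjTranspose * A ^ 3).trace.re := norm_sq_le_re_trace_conjTranspose_mul_self _
    _ = (A ^ 6).trace.re := by rw [(hA.pow 3).eq, ← pow_add]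

end HilbertSchmidt

/-! ### The conditional expectation onto the first tensor factor. -/

section LocalExpectation

variable {ι κ : Type*} [Fintype κ] [DecidableEq κ]

/-- The trace preserving conditional expectation `n⁻¹ • (id ⊗ Tr)(A) ⊗ 1` onto the first
tensor factor. -/
noncomputable def localExpectation :
    Matrix (ι × κ) (ι × κ) ℂ →ₗ[ℂ] Matrix (ι × κ) (ι × κ) ℂ where
  toFun A := Matrix.of fun x y =>
    if x.2 = y.2 then (Fintype.card κ : ℂ)⁻¹ * partialTraceSnd A x.1 y.1 else 0
  map_add' A B := by
    ext x y
    by_cases h : x.2 = y.2 <;>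
      simp [h, partialTraceSnd, Finset.sum_add_distrib, mul_add]
  map_smul' c A := by
    ext x y
    by_cases h : x.2 = y.2 <;>
      simp [h, partialTraceSnd, ← Finset.mul_sum, mul_left_comm]

theorem localExpectation_apply (A : Matrix (ι × κ) (ι × κ) ℂ) (x y : ι × κ) :
    localExpectation A x y =
      if x.2 = y.2 then (Fintype.card κ : ℂ)⁻¹ * partialTraceSnd A x.1 y.1 else 0 := rfl

theorem conjTranspose_localExpectation (A : Matrix (ι × κ) (ι × κ) ℂ) :
    (localExpectation A).conjTranspose = localExpectation A.conjTranspose := by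
  ext x y
  by_cases h : x.2 = y.2 <;>
    simp [h, partialTraceSnd, localExpectation_apply, Ne.symm]

theorem Matrix.IsHermitian.localExpectation {A : Matrix (ι × κ) (ι × κ) ℂ}
    (hA : A.IsHermitian) : (localExpectation A).IsHermitian := by
  rw [Matrix.IsHermitian, conjTranspose_localExpectation, hA.eq]

theorem partialTraceSnd_localExpectation [Nonempty κ] (A : Matrix (ι × κ) (ι × κ) ℂ) :
    partialTraceSnd (localExpectation A) = partialTraceSnd A := by
  ext a b
  simp only [partialTraceSnd, Matrix.of_apply, localExpectation_apply, if_true,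
    Finset.sum_const, Finset.card_univ, nsmul_eq_mul]
  rw [← mul_assoc, mul_inv_cancel₀ (Nat.cast_ne_zero.2 Fintype.card_ne_zero), one_mul]

variable [Fintype ι]

theorem trace_localExpectation_mul (A B : Matrix (ι × κ) (ι × κ) ℂ) :
    (localExpectation A * B).trace =
      (Fintype.card κ : ℂ)⁻¹ * (partialTraceSnd A * partialTraceSnd B).trace := by
  simp only [Matrix.trace, Matrix.diag_apply, Matrix.mul_apply, localExpectation_apply,
    Fintype.sum_prod_type, ite_mul, zero_mul, Finset.sum_ite_eq, Finset.mem_univ, if_true]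
  rw [Finset.mul_sum]
  refine Finset.sum_congr rfl fun a _ => ?_
  rw [Finset.sum_comm, Finset.mul_sum]
  refine Finset.sum_congr rfl fun b _ => ?_
  rw [← Finset.mul_sum, mul_assoc]
  rfl

theorem trace_localExpectation_mul_comm (A B : Matrix (ι × κ) (ι × κ) ℂ) :
    (localExpectation A * B).trace = (localExpectation B * A).trace := by
  rw [trace_localExpectation_mul, trace_localExpectation_mul, Matrix.trace_mul_comm]

variable [Nonempty κ]

theorem trace_localExpectation (A : Matrix (ι × κ) (ι × κ) ℂ) :
    (localExpectation A).trace = A.trace := by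
  have h (B : Matrix (ι × κ) (ι × κ) ℂ) : B.trace = (partialTraceSnd B).trace := by
    simp [Matrix.trace, partialTraceSnd, Fintype.sum_prod_type]
  rw [h, h A, partialTraceSnd_localExpectation]

theorem trace_localExpectation_mul_localExpectation (A B : Matrix (ι × κ) (ι × κ) ℂ) :
    (localExpectation A * localExpectation B).trace = (localExpectation A * B).trace := by
  rw [trace_localExpectation_mul, trace_localExpectation_mul, partialTraceSnd_localExpectation]

theorem normalizedTrace_localExpectation (A : Matrix (ι × κ) (ι × κ) ℂ) :
    normalizedTrace (localExpectation A) = normalizedTrace A := by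
  rw [normalizedTrace, normalizedTrace, trace_localExpectation]

end LocalExpectation

/-! ### The squared distance from the conditional expectation to the scalars. -/

section TraceDeviation

variable {ι κ : Type*} [Fintype ι] [Fintype κ] [DecidableEq κ]

/-- For Hermitian `A`, the squared Hilbert-Schmidt norm of
`localExpectation A - (normalizedTrace A) • 1`. -/
noncomputable def traceDeviation (A : Matrix (ι × κ) (ι × κ) ℂ) : ℝ :=
  ((localExpectation A * A).trace - A.trace ^ 2 / (Fintype.card (ι × κ) : ℂ)).re

variable [Nonempty κ]

/-- `localExpectation` is an orthogonal projection for the Hilbert-Schmidt product, hence a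
contraction; subtracting the squared trace term only decreases the left side. -/
theorem traceDeviation_le {A : Matrix (ι × κ) (ι × κ) ℂ}
    (hA : A.IsHermitian) : traceDeviation A ≤ (A * A).trace.re := by
  have h1 : 0 ≤ ((A - localExpectation A) * (A - localExpectation A)).trace.re :=
    re_trace_mul_self_nonneg (hA.sub hA.localExpectation)
  have h2 : ((A - localExpectation A) * (A - localExpectation A)).trace =
      (A * A).trace - (localExpectation A * A).trace := by
    simp only [sub_mul, mul_sub, Matrix.trace_sub, trace_localExpectation_mul_localExpectation]
    rw [Matrix.trace_mul_comm A (localExpectation A)]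
    ring
  have h3 : 0 ≤ (A.trace ^ 2 / (Fintype.card (ι × κ) : ℂ)).re := by
    have h4 : A.trace = (A.trace.re : ℂ) := Complex.ext rfl (by simp [hA.im_trace])
    rw [h4, ← Complex.ofReal_pow, ← Complex.ofReal_natCast, ← Complex.ofReal_div,
      Complex.ofReal_re]
    positivity
  rw [h2, Complex.sub_re] at h1
  rw [traceDeviation, Complex.sub_re]
  linarith

variable [DecidableEq ι]

theorem trace_mul_self_sub_smul_one {n : Type*} [Fintype n] [DecidableEq n] [Nonempty n]
    (X : Matrix n n ℂ) :
    ((X - normalizedTrace X • (1 : Matrix n n ℂ)) *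
      (X - normalizedTrace X • (1 : Matrix n n ℂ))).trace =
      (X * X).trace - X.trace ^ 2 / (Fintype.card n : ℂ) := by
  have hn : (Fintype.card n : ℂ) ≠ 0 := Nat.cast_ne_zero.2 Fintype.card_ne_zero
  simp only [sub_mul, mul_sub, Matrix.smul_mul, Matrix.mul_smul, one_mul, mul_one,
    Matrix.trace_sub, Matrix.trace_smul, Matrix.trace_one, smul_eq_mul, normalizedTrace]
  field_simp
  ring

theorem traceDeviation_eq [Nonempty ι] (A : Matrix (ι × κ) (ι × κ) ℂ) :
    traceDeviation A =
      ((localExpectation A - normalizedTrace A • (1 : Matrix (ι × κ) (ι × κ) ℂ)) *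
        (localExpectation A - normalizedTrace A • (1 : Matrix (ι × κ) (ι × κ) ℂ))).trace.re := by
  have h := trace_mul_self_sub_smul_one (localExpectation A)
  rw [normalizedTrace_localExpectation] at h
  rw [h, trace_localExpectation_mul_localExpectation, trace_localExpectation, traceDeviation]

theorem isHermitian_sub_normalizedTrace {n : Type*} [Fintype n] [DecidableEq n]
    {X A : Matrix n n ℂ} (hX : X.IsHermitian) (hA : A.IsHermitian) :
    (X - normalizedTrace A • (1 : Matrix n n ℂ)).IsHermitian := by
  have h : star (normalizedTrace A) = normalizedTrace A := by
    have h2 := Matrix.trace_conjTranspose A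
    rw [hA.eq] at h2
    rw [normalizedTrace, star_div₀, ← h2, star_natCast]
  rw [Matrix.IsHermitian, Matrix.conjTranspose_sub, hX.eq, Matrix.conjTranspose_smul, h,
    Matrix.conjTranspose_one]

theorem traceDeviation_nonneg [Nonempty ι] {A : Matrix (ι × κ) (ι × κ) ℂ}
    (hA : A.IsHermitian) : 0 ≤ traceDeviation A := by
  rw [traceDeviation_eq]
  exact re_trace_mul_self_nonneg (isHermitian_sub_normalizedTrace hA.localExpectation hA)

/-- The centred conditional expectation is `D ⊗ 1`, and tensoring with the identity multiplies the
squared Hilbert-Schmidt norm by the dimension of the second factor. -/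
theorem card_mul_norm_sq_le_traceDeviation [Nonempty ι] {A : Matrix (ι × κ) (ι × κ) ℂ}
    (hA : A.IsHermitian) :
    Fintype.card κ * ‖(Fintype.card κ : ℂ)⁻¹ • partialTraceSnd A
      - normalizedTrace A • (1 : Matrix ι ι ℂ)‖ ^ 2 ≤ traceDeviation A := by
  set D := (Fintype.card κ : ℂ)⁻¹ • partialTraceSnd A - normalizedTrace A • (1 : Matrix ι ι ℂ)
    with hD
  have hk : Matrix.kroneckerMap (fun x y => x * y) D (1 : Matrix κ κ ℂ) =
      localExpectation A - normalizedTrace A • (1 : Matrix (ι × κ) (ι × κ) ℂ) := by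
    ext ⟨a, k⟩ ⟨b, l⟩
    by_cases h : k = l <;> by_cases h' : a = b <;>
      simp [h, h', hD, localExpectation_apply, Matrix.kroneckerMap_apply]
  have hH := isHermitian_sub_normalizedTrace hA.localExpectation hA
  have h1 : traceDeviation A = Fintype.card κ * (D.conjTranspose * D).trace.re := by
    conv_lhs => rw [traceDeviation_eq]
    nth_rw 1 [← hH.eq]
    rw [← hk, Matrix.conjTranspose_kronecker, ← Matrix.mul_kronecker_mul, Matrix.trace_kronecker]
    simp [mul_comm]
  rw [h1]
  gcongr
  exact norm_sq_le_re_trace_conjTranspose_mul_self D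

/-- The left hand side is the squared Hilbert-Schmidt norm of the commutator of `A` and
`localExpectation A`. -/
theorem commutator_trace_le [Nonempty ι] {A : Matrix (ι × κ) (ι × κ) ℂ} (hA : A.IsHermitian) :
    -(2 * ((localExpectation A) * (A * localExpectation A * A
        - A * (A * localExpectation A))).trace).re
      ≤ 4 * ‖A‖ ^ 2 * traceDeviation A := by
  set Φ := localExpectation A with hΦ
  set X := Φ - normalizedTrace A • (1 : Matrix (ι × κ) (ι × κ) ℂ) with hX
  have hXH : X.IsHermitian := isHermitian_sub_normalizedTrace hA.localExpectation hA
  -- Scalars commute with `A`, so `Φ` may be replaced by its centred version `X`, whose squared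
  -- Hilbert-Schmidt norm is the deviation.
  have h0 : (Φ * (A * Φ * A - A * (A * Φ))).trace = (X * (A * X * A - A * (A * X))).trace := by
    rw [show Φ = X + normalizedTrace A • (1 : Matrix (ι × κ) (ι × κ) ℂ) by rw [hX]; abel]
    simp only [add_mul, mul_add, mul_sub, Matrix.smul_mul, Matrix.mul_smul, one_mul, mul_one,
      Matrix.trace_sub, Matrix.trace_smul, Matrix.trace_add, smul_eq_mul]
    rw [Matrix.trace_mul_comm (A * X) A]
    ring
  -- Positivity of the squared anticommutator bounds the squared commutator by `4 Tr(X A A X)`.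
  have h1 : 0 ≤ ((A * X + X * A) * (A * X + X * A)).trace.re := by
    refine re_trace_mul_self_nonneg ?_
    rw [Matrix.IsHermitian, Matrix.conjTranspose_add, Matrix.conjTranspose_mul,
      Matrix.conjTranspose_mul, hXH.eq, hA.eq, add_comm]
  have h2 : ((A * X + X * A) * (A * X + X * A)).trace =
      2 * (X * (A * X * A)).trace + 2 * (X * (A * (A * X))).trace := by
    simp only [add_mul, mul_add, Matrix.trace_add]
    rw [show A * X * (A * X) = A * (X * A * X) by simp only [mul_assoc],
      Matrix.trace_mul_comm A (X * A * X),
      show A * X * (X * A) = (A * X * X) * A by simp only [mul_assoc],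
      Matrix.trace_mul_comm (A * X * X) A,
      show A * (A * X * X) = (A * (A * X)) * X by simp only [mul_assoc],
      Matrix.trace_mul_comm (A * (A * X)) X]
    simp only [mul_assoc]
    ring
  have h3 : (X * (A * (A * X))).trace.re ≤ ‖A‖ ^ 2 * traceDeviation A := by
    have h := re_trace_conjTranspose_mul_self_mul_le A X
    rw [Matrix.conjTranspose_mul, hXH.eq, hA.eq, mul_assoc X A] at h
    rwa [traceDeviation_eq]
  rw [h2] at h1
  rw [h0, mul_sub, Matrix.trace_sub]
  simp only [Complex.add_re, Complex.mul_re, Complex.sub_re, Complex.re_ofNat, Complex.im_ofNat,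
    zero_mul, sub_zero] at h1 ⊢
  linarith

end TraceDeviation

/-! ### Borel structure on matrices and infinitesimal unitary invariance. -/

instance Matrix.instBorelSpaceComplex {m n : Type*} [Countable m] [Countable n] :
    BorelSpace (Matrix m n ℂ) :=
  inferInstanceAs (BorelSpace (m → n → ℂ))

instance Matrix.instSecondCountableTopologyComplex {m n : Type*} [Countable m] [Countable n] :
    SecondCountableTopology (Matrix m n ℂ) :=
  inferInstanceAs (SecondCountableTopology (m → n → ℂ))

section UnitaryInvariance

variable {n : Type*} [Fintype n] [DecidableEq n]

theorem Continuous.integrable_of_ae_norm_le {E F : Type*} [NormedAddCommGroup E]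
    [ProperSpace E] [MeasurableSpace E] [BorelSpace E] [SecondCountableTopology E]
    [NormedAddCommGroup F] {ν : Measure E} [IsFiniteMeasure ν] {K : ℝ}
    (hK : ∀ᵐ A ∂ν, ‖A‖ ≤ K) {g : E → F} (hg : Continuous g) : Integrable g ν := by
  obtain ⟨C, hC⟩ := (isCompact_closedBall (0 : E) K).exists_bound_of_continuousOn hg.continuousOn
  refine Integrable.of_bound hg.aestronglyMeasurable C ?_
  filter_upwards [hK] with A hA
  exact hC A (by simpa using hA)

/-- The integral of `F (exp (tY) A exp (-tY))` does not depend on `t`, and its derivative at `t = 0`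
is the integral in question. -/
theorem integral_fderiv_commutator_eq_zero {ν : Measure (Matrix n n ℂ)} [IsFiniteMeasure ν]
    (hν : ∀ U ∈ Matrix.unitaryGroup n ℂ, ν.map (fun A => U * A * star U) = ν)
    {K : ℝ} (hK : ∀ᵐ A ∂ν, ‖A‖ ≤ K) {F : Matrix n n ℂ → ℂ} (hF : ContDiff ℝ 1 F)
    {Y : Matrix n n ℂ} (hY : star Y = -Y) :
    ∫ A, fderiv ℝ F A (Y * A - A * Y) ∂ν = 0 := by
  have : ProperSpace (Matrix n n ℂ) := FiniteDimensional.proper ℝ _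
  let _ : NormedAlgebra ℚ (Matrix n n ℂ) := .restrictScalars ℚ ℂ _
  set U : ℝ → Matrix n n ℂ := fun t => NormedSpace.exp (t • Y) with hU
  set V : ℝ → Matrix n n ℂ := fun t => NormedSpace.exp (t • (-Y)) with hV
  have hsV (t : ℝ) : star (U t) = V t := by
    rw [hU, hV]
    simp only [NormedSpace.star_exp, star_smul, hY, star_trivial]
  have hmem (t : ℝ) : U t ∈ Matrix.unitaryGroup n ℂ := by
    refine NormedSpace.exp_mem_unitary_of_mem_skewAdjoint ?_
    rw [skewAdjoint.mem_iff, star_smul, hY, star_trivial, smul_neg]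
  have hderiv (A : Matrix n n ℂ) (t : ℝ) : HasDerivAt (fun t => U t * A * V t)
      (Y * (U t * A * V t) - (U t * A * V t) * Y) t := by
    have h := ((hasDerivAt_exp_smul_const' (𝕂 := ℝ) Y t).mul_const A).mul
      (hasDerivAt_exp_smul_const (𝕂 := ℝ) (-Y) t)
    refine h.congr_deriv ?_
    simp only [hU, hV, mul_neg, ← mul_assoc, sub_eq_add_neg]
  have hF' : Continuous fun A => fderiv ℝ F A (Y * A - A * Y) :=
    (hF.continuous_fderiv one_ne_zero).clm_apply (by fun_prop)
  have hcont (t : ℝ) : Continuous fun A : Matrix n n ℂ => U t * A * V t := by fun_prop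
  obtain ⟨C, hC⟩ := (isCompact_closedBall (0 : Matrix n n ℂ) K).exists_bound_of_continuousOn
    hF'.continuousOn
  have hmain := (hasDerivAt_integral_of_dominated_loc_of_deriv_le (μ := ν)
    (F := fun t A => F (U t * A * V t))
    (F' := fun t A => fderiv ℝ F (U t * A * V t)
      (Y * (U t * A * V t) - (U t * A * V t) * Y)) (x₀ := 0) (s := Set.univ) (bound := fun _ => C)
    univ_mem
    (Eventually.of_forall fun t => (hF.continuous.comp (hcont t)).aestronglyMeasurable)
    ((hF.continuous.comp (hcont 0)).integrable_of_ae_norm_le hK)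
    ((hF'.comp (hcont 0)).aestronglyMeasurable)
    (by
      -- Unitary conjugation preserves the ball of radius `K`, so one bound for the derivative on
      -- that compact ball dominates for all `t`.
      filter_upwards [hK] with A hA t _
      refine hC _ ?_
      rw [mem_closedBall_zero_iff, ← hsV,
        CStarRing.norm_mul_mem_unitary _ (Unitary.star_mem (hmem t)),
        CStarRing.norm_mem_unitary_mul _ (hmem t)]
      exact hA)
    (integrable_const C)
    (Eventually.of_forall fun A t _ =>
      ((hF.differentiable one_ne_zero).differentiableAt.hasFDerivAt.comp_hasDerivAt t
        (hderiv A t)))).2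
  have hconst : (fun t => ∫ A, F (U t * A * V t) ∂ν) = fun _ => ∫ A, F A ∂ν := by
    funext t
    conv_rhs => rw [← hν (U t) (hmem t)]
    rw [integral_map (by rw [hsV]; exact (hcont t).aemeasurable)
      hF.continuous.aestronglyMeasurable, hsV]
  rw [hconst] at hmain
  have h0 := hmain.unique (hasDerivAt_const _ _)
  simpa [hU, hV] using h0

end UnitaryInvariance

/-! ### The loop equation for a general direction. -/

section LoopEquation

variable {ι κ : Type*} [Fintype ι] [Fintype κ] [DecidableEq κ]

/-- The derivative at `A`, in the direction of the commutator of `Y` and `A`, of the `(x, y)` entry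
of `A * localExpectation A` times `h (traceDeviation A)`, as a complex linear function of `Y`. -/
noncomputable def loopIntegrand (h : ℝ → ℝ) (x y : ι × κ) (Y A : Matrix (ι × κ) (ι × κ) ℂ) : ℂ :=
  ((Y * A - A * Y) * localExpectation A + A * localExpectation (Y * A - A * Y)) x y *
      h (traceDeviation A) +
    (A * localExpectation A) x y * (deriv h (traceDeviation A) *
      (2 * (localExpectation A * (Y * A - A * Y)).trace))

theorem loopIntegrand_add (h : ℝ → ℝ) (x y : ι × κ) (Y Y' A : Matrix (ι × κ) (ι × κ) ℂ) :
    loopIntegrand h x y (Y + Y') A = loopIntegrand h x y Y A + loopIntegrand h x y Y' A := by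
  have h0 : (Y + Y') * A - A * (Y + Y') = (Y * A - A * Y) + (Y' * A - A * Y') := by
    simp only [add_mul, mul_add]; abel
  rw [loopIntegrand, loopIntegrand, loopIntegrand, h0, map_add, add_mul, mul_add, mul_add,
    Matrix.trace_add]
  simp only [Matrix.add_apply]
  ring

theorem loopIntegrand_smul (h : ℝ → ℝ) (x y : ι × κ) (c : ℂ)
    (Y A : Matrix (ι × κ) (ι × κ) ℂ) :
    loopIntegrand h x y (c • Y) A = c * loopIntegrand h x y Y A := by
  simp only [loopIntegrand, Matrix.smul_mul, Matrix.mul_smul, ← smul_sub, map_smul,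
    ← smul_add, Matrix.smul_apply, Matrix.trace_smul, smul_eq_mul]
  ring

variable [DecidableEq ι]

theorem HasDerivAt.linearMap_comp {E F : Type*} [NormedAddCommGroup E] [NormedSpace ℂ E]
    [FiniteDimensional ℂ E] [NormedAddCommGroup F] [NormedSpace ℂ F] (L : E →ₗ[ℂ] F)
    {γ : ℝ → E} {γ' : E} {t : ℝ} (hγ : HasDerivAt γ γ' t) :
    HasDerivAt (fun s => L (γ s)) (L γ') t :=
  (L.toContinuousLinearMap.restrictScalars ℝ).hasFDerivAt.comp_hasDerivAt t hγ

theorem LinearMap.contDiff_real {E F : Type*} [NormedAddCommGroup E] [NormedSpace ℂ E]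
    [FiniteDimensional ℂ E] [NormedAddCommGroup F] [NormedSpace ℂ F] (L : E →ₗ[ℂ] F)
    {k : WithTop ℕ∞} : ContDiff ℝ k L :=
  (L.toContinuousLinearMap.restrictScalars ℝ).contDiff

theorem contDiff_localExpectation {k : WithTop ℕ∞} :
    ContDiff ℝ k (localExpectation (ι := ι) (κ := κ)) :=
  LinearMap.contDiff_real (localExpectation (ι := ι) (κ := κ))

theorem contDiff_traceDeviation {k : WithTop ℕ∞} :
    ContDiff ℝ k (traceDeviation (ι := ι) (κ := κ)) := by
  have h1 : ContDiff ℝ k fun A : Matrix (ι × κ) (ι × κ) ℂ => (localExpectation A * A).trace :=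
    (Matrix.traceLinearMap (ι × κ) ℂ ℂ).contDiff_real.comp
      (contDiff_localExpectation.mul contDiff_id)
  have h2 : ContDiff ℝ k fun A : Matrix (ι × κ) (ι × κ) ℂ => A.trace :=
    (Matrix.traceLinearMap (ι × κ) ℂ ℂ).contDiff_real
  exact Complex.reCLM.contDiff.comp (h1.sub ((h2.pow 2).div_const _))

theorem hasDerivAt_traceDeviation {γ : ℝ → Matrix (ι × κ) (ι × κ) ℂ}
    {Z : Matrix (ι × κ) (ι × κ) ℂ} {t : ℝ} (hγ : HasDerivAt γ Z t) (hZ : Z.trace = 0) :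
    HasDerivAt (fun s => traceDeviation (γ s))
      (2 * (localExpectation (γ t) * Z).trace).re t := by
  have h1 := ((hγ.linearMap_comp localExpectation).mul hγ).linearMap_comp
    (Matrix.traceLinearMap (ι × κ) ℂ ℂ)
  have h2 := hγ.linearMap_comp (Matrix.traceLinearMap (ι × κ) ℂ ℂ)
  have h3 := Complex.reCLM.hasFDerivAt.comp_hasDerivAt t
    (h1.sub ((h2.pow 2).div_const (Fintype.card (ι × κ) : ℂ)))
  refine h3.congr_deriv ?_
  simp only [Matrix.traceLinearMap_apply, hZ, mul_zero, zero_div, sub_zero, Matrix.trace_add,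
    Complex.reCLM_apply]
  rw [trace_localExpectation_mul_comm Z, two_mul]

theorem trace_commutator {n : Type*} [Fintype n] (Y A : Matrix n n ℂ) :
    (Y * A - A * Y).trace = 0 := by
  rw [Matrix.trace_sub, Matrix.trace_mul_comm, sub_self]

theorem contDiff_entry_mul_comp_traceDeviation {h : ℝ → ℝ} (hh : ContDiff ℝ 1 h) (x y : ι × κ) :
    ContDiff ℝ 1 fun A : Matrix (ι × κ) (ι × κ) ℂ =>
      (A * localExpectation A) x y * (h (traceDeviation A) : ℂ) := by
  have h1 : ContDiff ℝ 1 fun A : Matrix (ι × κ) (ι × κ) ℂ => A * localExpectation A :=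
    contDiff_id.mul contDiff_localExpectation
  have h2 : ContDiff ℝ 1 fun A : Matrix (ι × κ) (ι × κ) ℂ => (A * localExpectation A) x y :=
    (Matrix.entryLinearMap ℂ ℂ x y).contDiff_real.comp h1
  have h3 : ContDiff ℝ 1 fun A : Matrix (ι × κ) (ι × κ) ℂ => (h (traceDeviation A) : ℂ) :=
    Complex.ofRealCLM.contDiff.comp (hh.comp contDiff_traceDeviation)
  exact h2.mul h3

/-- The derivative of `traceDeviation` is a real part, only real linear in the direction. For `A`
Hermitian and `Y` skew the commutator is Hermitian, the trace is already real, and the complex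
linear formula applies. -/
theorem fderiv_entry_mul_comp_traceDeviation {h : ℝ → ℝ} (hh : ContDiff ℝ 1 h) (x y : ι × κ)
    {A Y : Matrix (ι × κ) (ι × κ) ℂ} (hA : A.IsHermitian) (hY : star Y = -Y) :
    fderiv ℝ (fun A : Matrix (ι × κ) (ι × κ) ℂ =>
      (A * localExpectation A) x y * (h (traceDeviation A) : ℂ)) A (Y * A - A * Y) =
      loopIntegrand h x y Y A := by
  set Z := Y * A - A * Y with hZ
  have hZH : Z.IsHermitian := by
    rw [Matrix.star_eq_conjTranspose] at hY
    rw [Matrix.IsHermitian, hZ, Matrix.conjTranspose_sub, Matrix.conjTranspose_mul,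
      Matrix.conjTranspose_mul, hA.eq, hY]
    simp only [mul_neg, neg_mul]
    abel
  have hreal : (((2 * (localExpectation A * Z).trace).re : ℝ) : ℂ) =
      2 * (localExpectation A * Z).trace := by
    refine Complex.conj_eq_iff_re.1 ?_
    rw [map_mul, ← Complex.star_def, ← Matrix.trace_conjTranspose,
      Matrix.conjTranspose_mul, hZH.eq, hA.localExpectation.eq, Matrix.trace_mul_comm]
    simp
  have hγ : HasDerivAt (fun s : ℝ => A + s • Z) Z 0 := by
    simpa using ((hasDerivAt_id (0 : ℝ)).smul_const Z).const_add A
  have h0 : A + (0 : ℝ) • Z = A := by simp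
  have h1 := (hγ.mul (hγ.linearMap_comp localExpectation)).linearMap_comp
    (Matrix.entryLinearMap ℂ ℂ x y)
  have h2 := (((hh.differentiable one_ne_zero).differentiableAt.hasDerivAt).comp (0 : ℝ)
    (hasDerivAt_traceDeviation hγ (trace_commutator Y A))).ofReal_comp
  have h3 := ((contDiff_entry_mul_comp_traceDeviation hh x y).differentiable
    one_ne_zero (A + (0 : ℝ) • Z)).hasFDerivAt.comp_hasDerivAt (0 : ℝ) hγ
  have h4 := h3.unique (h1.mul h2)
  rw [h0] at h4
  rw [h4, loopIntegrand]
  simp only [Complex.ofReal_mul, hreal, Matrix.entryLinearMap_apply, Pi.mul_apply, h0]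
  rfl

theorem continuous_loopIntegrand {h : ℝ → ℝ} (hh : ContDiff ℝ 1 h) (x y : ι × κ)
    (Y : Matrix (ι × κ) (ι × κ) ℂ) : Continuous (loopIntegrand h x y Y) := by
  have hΦ : Continuous (localExpectation (ι := ι) (κ := κ)) :=
    (contDiff_localExpectation (k := 0)).continuous
  have hq : Continuous (traceDeviation (ι := ι) (κ := κ)) :=
    (contDiff_traceDeviation (k := 0)).continuous
  have hZ : Continuous fun A : Matrix (ι × κ) (ι × κ) ℂ => Y * A - A * Y := by fun_prop
  have hd := hh.continuous_deriv_one
  have hc := hh.continuous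
  unfold loopIntegrand
  refine .add (.mul ?_ ?_) (.mul ?_ (.mul ?_ (.mul ?_ ?_)))
  · exact ((hZ.mul hΦ).add (continuous_id.mul (hΦ.comp hZ))).matrix_elem x y
  · exact Complex.continuous_ofReal.comp (hc.comp hq)
  · exact (continuous_id.mul hΦ).matrix_elem x y
  · exact Complex.continuous_ofReal.comp (hd.comp hq)
  · exact continuous_const
  · exact (hΦ.mul hZ).matrix_trace

/-- Skew-Hermitian directions span all matrices over `ℂ`, and `loopIntegrand` is complex linear in
the direction. This makes the non-skew matrix units admissible. -/
theorem integral_loopIntegrand_eq_zero {ν : Measure (Matrix (ι × κ) (ι × κ) ℂ)}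
    [IsFiniteMeasure ν]
    (hν : ∀ U ∈ Matrix.unitaryGroup (ι × κ) ℂ, ν.map (fun A => U * A * star U) = ν)
    (hH : ∀ᵐ A ∂ν, A.IsHermitian) {K : ℝ} (hK : ∀ᵐ A ∂ν, ‖A‖ ≤ K)
    {h : ℝ → ℝ} (hh : ContDiff ℝ 1 h) (x y : ι × κ) (Y : Matrix (ι × κ) (ι × κ) ℂ) :
    ∫ A, loopIntegrand h x y Y A ∂ν = 0 := by
  have : ProperSpace (Matrix (ι × κ) (ι × κ) ℂ) := FiniteDimensional.proper ℝ _
  have hskew (Y : Matrix (ι × κ) (ι × κ) ℂ) (hY : star Y = -Y) :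
      ∫ A, loopIntegrand h x y Y A ∂ν = 0 := by
    rw [← integral_fderiv_commutator_eq_zero hν hK
      (contDiff_entry_mul_comp_traceDeviation hh x y) hY]
    refine integral_congr_ae ?_
    filter_upwards [hH] with A hA
    exact (fderiv_entry_mul_comp_traceDeviation hh x y hA hY).symm
  have hint (Y : Matrix (ι × κ) (ι × κ) ℂ) : Integrable (loopIntegrand h x y Y) ν :=
    (continuous_loopIntegrand hh x y Y).integrable_of_ae_norm_le hK
  have h1 : star (Y - star Y) = -(Y - star Y) := by rw [star_sub, star_star, neg_sub]
  have h2 : star (Complex.I • (Y + star Y)) = -(Complex.I • (Y + star Y)) := by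
    rw [star_smul, star_add, star_star, Complex.star_def, Complex.conj_I, neg_smul, add_comm]
  have hdec : Y = (2⁻¹ : ℂ) • (Y - star Y) +
      (-(2⁻¹ : ℂ) * Complex.I) • (Complex.I • (Y + star Y)) := by
    rw [smul_smul, mul_assoc, Complex.I_mul_I, neg_mul_neg, mul_one, ← smul_add, sub_add_add_cancel,
      ← two_smul ℂ, smul_smul, inv_mul_cancel₀ two_ne_zero, one_smul]
  rw [hdec]
  simp only [loopIntegrand_add, loopIntegrand_smul h x y (2⁻¹ : ℂ),
    loopIntegrand_smul h x y (-(2⁻¹ : ℂ) * Complex.I)]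
  rw [integral_add ((hint _).const_mul _) ((hint _).const_mul _), integral_const_mul,
    integral_const_mul, hskew _ h1, hskew _ h2, mul_zero, mul_zero, add_zero]

end LoopEquation

/-! ### Summing the loop equation over matrix units. -/

section LoopSum

variable {n : Type*} [Fintype n] [DecidableEq n]

theorem single_one_mul_apply (x y z w : n) (M : Matrix n n ℂ) :
    (Matrix.single x y (1 : ℂ) * M) z w = if z = x then M y w else 0 := by
  split_ifs with h
  · subst h; simp
  · simp [h]

theorem mul_single_one_apply (x y z w : n) (M : Matrix n n ℂ) :
    (M * Matrix.single x y (1 : ℂ)) z w = if w = y then M z x else 0 := by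
  split_ifs with h
  · subst h; simp
  · simp [h]

theorem sum_commutator_single_mul (A B : Matrix n n ℂ) :
    ∑ x : n, ∑ y : n, ((Matrix.single x y (1 : ℂ) * A - A * Matrix.single x y (1 : ℂ)) * B) x y =
      Fintype.card n * (A * B).trace - A.trace * B.trace := by
  have h (x y : n) : ((Matrix.single x y (1 : ℂ) * A - A * Matrix.single x y (1 : ℂ)) * B) x y =
      (A * B) y y - A x x * B y y := by
    rw [sub_mul, mul_assoc, mul_assoc, Matrix.sub_apply, single_one_mul_apply, if_pos rfl,
      Matrix.mul_apply (M := A) (N := Matrix.single x y (1 : ℂ) * B)]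
    simp [single_one_mul_apply]
  simp only [h, Finset.sum_sub_distrib, Finset.sum_const, Finset.card_univ, nsmul_eq_mul]
  rw [← Finset.sum_mul_sum]
  rfl

theorem sum_mul_trace_mul_commutator_single (W A B : Matrix n n ℂ) :
    ∑ x, ∑ y, W x y * (B * (Matrix.single x y (1 : ℂ) * A - A * Matrix.single x y (1 : ℂ))).trace =
      (B * (W * A - A * W)).trace := by
  conv_rhs => rw [Matrix.matrix_eq_sum_single W]
  simp only [Finset.sum_mul, Finset.mul_sum, ← Finset.sum_sub_distrib, Matrix.trace_sum]
  refine Finset.sum_congr rfl fun x _ => Finset.sum_congr rfl fun y _ => ?_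
  rw [show Matrix.single x y (W x y) = W x y • Matrix.single x y (1 : ℂ) by simp,
    Matrix.smul_mul, Matrix.mul_smul, ← smul_sub, Matrix.mul_smul, Matrix.trace_smul, smul_eq_mul]

variable {ι κ : Type*} [Fintype ι] [Fintype κ] [DecidableEq ι] [DecidableEq κ]

theorem partialTraceSnd_commutator_single (A : Matrix (ι × κ) (ι × κ) ℂ) (a b c : ι) (k l : κ) :
    partialTraceSnd (Matrix.single (a, k) (b, l) (1 : ℂ) * A
      - A * Matrix.single (a, k) (b, l) (1 : ℂ)) c b =
      (if c = a then A (b, l) (b, k) else 0) - A (c, l) (a, k) := by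
  simp only [partialTraceSnd, Matrix.of_apply, Matrix.sub_apply, single_one_mul_apply,
    mul_single_one_apply, Prod.mk.injEq, Finset.sum_sub_distrib, ite_and]
  by_cases h : c = a <;> simp [h]

theorem sum_mul_localExpectation_commutator_single (A : Matrix (ι × κ) (ι × κ) ℂ) :
    ∑ x : ι × κ, ∑ y : ι × κ, (A * localExpectation (Matrix.single x y (1 : ℂ) * A
        - A * Matrix.single x y (1 : ℂ))) x y =
      (Fintype.card κ : ℂ)⁻¹ * (∑ k, ∑ l, (∑ a, A (a, k) (a, l)) * (∑ b, A (b, l) (b, k))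
        - Fintype.card ι * (A * A).trace) := by
  have h (a b : ι) (k l : κ) : (A * localExpectation (Matrix.single (a, k) (b, l) (1 : ℂ) * A
      - A * Matrix.single (a, k) (b, l) (1 : ℂ))) (a, k) (b, l) =
      (Fintype.card κ : ℂ)⁻¹ * (A (a, k) (a, l) * A (b, l) (b, k)
        - ∑ c, A (a, k) (c, l) * A (c, l) (a, k)) := by
    rw [Matrix.mul_apply, Fintype.sum_prod_type]
    simp only [localExpectation_apply, partialTraceSnd_commutator_single, mul_ite, mul_zero,
      Finset.sum_ite_eq', Finset.mem_univ, if_true, mul_sub, Finset.sum_sub_distrib,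
      Finset.mul_sum]
    refine congrArg₂ _ ?_ (Finset.sum_congr rfl fun c _ => ?_)
    · exact mul_left_comm _ _ _
    · exact mul_left_comm _ _ _
  simp only [Fintype.sum_prod_type, h, ← Finset.mul_sum, Finset.sum_sub_distrib]
  congr 2
  · rw [Finset.sum_comm]
    refine Finset.sum_congr rfl fun k _ => ?_
    simp only [Finset.sum_mul_sum]
    rw [Finset.sum_comm (γ := κ)]
    exact Finset.sum_congr rfl fun a _ => Finset.sum_comm
  · simp only [Finset.sum_const, Finset.card_univ, nsmul_eq_mul, ← Finset.mul_sum]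
    congr 1
    simp only [Matrix.trace, Matrix.diag_apply, Matrix.mul_apply, Fintype.sum_prod_type]
    refine Finset.sum_congr rfl fun a _ => Finset.sum_congr rfl fun k _ => Finset.sum_comm

/-- The three terms come from differentiating the three factors `A`, `localExpectation A` and `h`.
The first has real part `N` times the deviation, which is why `A * localExpectation A` is the
function tested. -/
theorem sum_loopIntegrand_single [Nonempty ι] [Nonempty κ] (h : ℝ → ℝ)
    (A : Matrix (ι × κ) (ι × κ) ℂ) :
    ∑ x, ∑ y, loopIntegrand h x y (Matrix.single x y (1 : ℂ)) A =
      (Fintype.card (ι × κ) * ((localExpectation A * A).trace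
          - A.trace ^ 2 / (Fintype.card (ι × κ) : ℂ))
        + (Fintype.card κ : ℂ)⁻¹ * (∑ k, ∑ l, (∑ a, A (a, k) (a, l)) * (∑ b, A (b, l) (b, k))
          - Fintype.card ι * (A * A).trace)) * h (traceDeviation A)
      + deriv h (traceDeviation A) * (2 * (localExpectation A * (A * localExpectation A * A
        - A * (A * localExpectation A))).trace) := by
  have hN : (Fintype.card (ι × κ) : ℂ) ≠ 0 := Nat.cast_ne_zero.2 Fintype.card_ne_zero
  have h1 := sum_commutator_single_mul A (localExpectation A)
  rw [trace_localExpectation, Matrix.trace_mul_comm A] at h1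
  have h2 := sum_mul_localExpectation_commutator_single A
  have h3 := sum_mul_trace_mul_commutator_single (A * localExpectation A) A (localExpectation A)
  have h4 (x y : ι × κ) : loopIntegrand h x y (Matrix.single x y (1 : ℂ)) A =
      (((Matrix.single x y (1 : ℂ) * A - A * Matrix.single x y (1 : ℂ)) * localExpectation A) x y
        + (A * localExpectation (Matrix.single x y (1 : ℂ) * A
          - A * Matrix.single x y (1 : ℂ))) x y) * h (traceDeviation A) +
      deriv h (traceDeviation A) * 2 * ((A * localExpectation A) x y * (localExpectation A *
        (Matrix.single x y (1 : ℂ) * A - A * Matrix.single x y (1 : ℂ))).trace) := by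
    rw [loopIntegrand, Matrix.add_apply]
    ring
  simp only [h4, Finset.sum_add_distrib, ← Finset.sum_mul, ← Finset.mul_sum]
  rw [h1, h2, h3, mul_sub (Fintype.card (ι × κ) : ℂ), mul_div_cancel₀ _ hN]
  ring

theorem le_re_sum_loopIntegrand_single [Nonempty ι] [Nonempty κ] {h : ℝ → ℝ} {K L : ℝ}
    {A : Matrix (ι × κ) (ι × κ) ℂ} (hA : A.IsHermitian) (hK : ‖A‖ ≤ K)
    (hL : (A * A).trace.re ≤ L) (h0 : 0 ≤ h (traceDeviation A))
    (h0' : 0 ≤ deriv h (traceDeviation A)) :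
    (Fintype.card (ι × κ) * traceDeviation A - Fintype.card ι / Fintype.card κ * L)
        * h (traceDeviation A)
      - 4 * K ^ 2 * (traceDeviation A * deriv h (traceDeviation A)) ≤
      (∑ x, ∑ y, loopIntegrand h x y (Matrix.single x y (1 : ℂ)) A).re := by
  rw [sum_loopIntegrand_single, Complex.add_re, Complex.re_mul_ofReal, Complex.re_ofReal_mul]
  have h1 := commutator_trace_le hA
  -- This is the squared Hilbert-Schmidt norm of the other partial trace `Tr ⊗ id`; having a
  -- favourable sign, it is discarded.
  have h2 : 0 ≤ (∑ k, ∑ l, (∑ a, A (a, k) (a, l)) * (∑ b, A (b, l) (b, k))).re := by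
    rw [Complex.re_sum]
    refine Finset.sum_nonneg fun k _ => ?_
    rw [Complex.re_sum]
    refine Finset.sum_nonneg fun l _ => ?_
    have : ∑ b, A (b, l) (b, k) = star (∑ a, A (a, k) (a, l)) := by
      rw [star_sum]
      exact Finset.sum_congr rfl fun b _ => (hA.apply _ _).symm
    rw [this, Complex.star_def, Complex.mul_conj, Complex.ofReal_re]
    exact Complex.normSq_nonneg _
  have h3 : 4 * ‖A‖ ^ 2 * traceDeviation A ≤ 4 * K ^ 2 * traceDeviation A := by
    have := traceDeviation_nonneg hA
    gcongr
  have h4 : (Fintype.card (ι × κ) * traceDeviation A - Fintype.card ι / Fintype.card κ * L) ≤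
      (Fintype.card (ι × κ) * ((localExpectation A * A).trace
          - A.trace ^ 2 / (Fintype.card (ι × κ) : ℂ))
        + (Fintype.card κ : ℂ)⁻¹ * (∑ k, ∑ l, (∑ a, A (a, k) (a, l)) * (∑ b, A (b, l) (b, k))
          - Fintype.card ι * (A * A).trace)).re := by
    rw [← Complex.ofReal_natCast (Fintype.card (ι × κ)), ← Complex.ofReal_natCast,
      ← Complex.ofReal_natCast, ← Complex.ofReal_inv, Complex.add_re, Complex.re_ofReal_mul,
      Complex.re_ofReal_mul, Complex.sub_re (∑ k, _), Complex.re_ofReal_mul, traceDeviation,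
      ← Complex.ofReal_natCast (Fintype.card (ι × κ))]
    have h5 : (Fintype.card ι : ℝ) / Fintype.card κ * (A * A).trace.re ≤
      Fintype.card ι / Fintype.card κ * L := by gcongr
    have h6 : 0 ≤ (Fintype.card κ : ℝ)⁻¹ *
      (∑ k, ∑ l, (∑ a, A (a, k) (a, l)) * (∑ b, A (b, l) (b, k))).re := by positivity
    rw [mul_sub (Fintype.card κ : ℝ)⁻¹]
    have h7 : (Fintype.card ι : ℝ) / Fintype.card κ * (A * A).trace.re =
        (Fintype.card κ : ℝ)⁻¹ * (Fintype.card ι * (A * A).trace.re) := by ring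
    linarith
  have h5 := mul_le_mul_of_nonneg_right h4 h0
  have h6 := mul_le_mul_of_nonneg_right (h1.trans h3) h0'
  linarith

end LoopSum

/-! ### Truncated powers and the tail of the deviation. -/

section TailBound

theorem hasDerivAt_posPart_pow (k : ℕ) (x : ℝ) :
    HasDerivAt (fun x : ℝ => max x 0 ^ (k + 2)) ((k + 2 : ℝ) * max x 0 ^ (k + 1)) x := by
  rcases lt_trichotomy x 0 with hx | hx | hx
  · rw [max_eq_right hx.le, zero_pow (by omega), mul_zero]
    refine (hasDerivAt_const x (0 : ℝ)).congr_of_eventuallyEq ?_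
    filter_upwards [Iio_mem_nhds hx] with y hy
    rw [max_eq_right (le_of_lt hy), zero_pow (by omega)]
  · subst hx
    rw [max_self, zero_pow (by omega), mul_zero, hasDerivAt_iff_isLittleO]
    simp only [max_self, sub_zero, smul_zero, zero_pow (Nat.succ_ne_zero (k + 1))]
    -- At the corner, the positive part is dominated by `|y|`, and `y ^ (k + 2)` is `o(y)`.
    refine Asymptotics.IsBigO.trans_isLittleO (g := fun y : ℝ => y ^ (k + 2)) ?_
      (Asymptotics.isLittleO_pow_id (by omega))
    refine Asymptotics.IsBigO.of_bound 1 (Eventually.of_forall fun y => ?_)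
    rw [norm_pow, norm_pow, one_mul]
    refine pow_le_pow_left₀ (norm_nonneg _) ?_ _
    rw [Real.norm_eq_abs, Real.norm_eq_abs, abs_of_nonneg (le_max_right _ _)]
    exact max_le (le_abs_self y) (abs_nonneg y)
  · rw [max_eq_left hx.le]
    refine ((hasDerivAt_pow (k + 2) x).congr_of_eventuallyEq ?_).congr_deriv (by push_cast; ring_nf)
    filter_upwards [Ioi_mem_nhds hx] with y hy
    rw [max_eq_left (le_of_lt hy)]

theorem hasDerivAt_posPart_sub_pow (c : ℝ) (k : ℕ) (x : ℝ) :
    HasDerivAt (fun x : ℝ => max (x - c) 0 ^ (k + 2)) ((k + 2 : ℝ) * max (x - c) 0 ^ (k + 1)) x :=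
  HasDerivAt.comp_sub_const x c (hasDerivAt_posPart_pow k (x - c))

theorem deriv_posPart_sub_pow (c : ℝ) (k : ℕ) :
    deriv (fun x : ℝ => max (x - c) 0 ^ (k + 2)) =
      fun x => (k + 2 : ℝ) * max (x - c) 0 ^ (k + 1) :=
  funext fun x => (hasDerivAt_posPart_sub_pow c k x).deriv

theorem contDiff_posPart_sub_pow (c : ℝ) (k : ℕ) :
    ContDiff ℝ 1 fun x : ℝ => max (x - c) 0 ^ (k + 2) := by
  rw [contDiff_one_iff_deriv, deriv_posPart_sub_pow]
  exact ⟨fun x => (hasDerivAt_posPart_sub_pow c k x).differentiableAt, by fun_prop⟩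

variable {ι κ : Type*} [Fintype ι] [Fintype κ] [DecidableEq ι] [DecidableEq κ]
  [Nonempty ι] [Nonempty κ]

theorem integral_loop_le_zero {ν : Measure (Matrix (ι × κ) (ι × κ) ℂ)} [IsFiniteMeasure ν]
    (hν : ∀ U ∈ Matrix.unitaryGroup (ι × κ) ℂ, ν.map (fun A => U * A * star U) = ν)
    (hH : ∀ᵐ A ∂ν, A.IsHermitian) {K L : ℝ} (hK : ∀ᵐ A ∂ν, ‖A‖ ≤ K)
    (hL : ∀ᵐ A ∂ν, (A * A).trace.re ≤ L)
    {h : ℝ → ℝ} (hh : ContDiff ℝ 1 h) (h0 : ∀ x, 0 ≤ h x) (h0' : ∀ x, 0 ≤ deriv h x) :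
    ∫ A, ((Fintype.card (ι × κ) * traceDeviation A - Fintype.card ι / Fintype.card κ * L)
        * h (traceDeviation A)
      - 4 * K ^ 2 * (traceDeviation A * deriv h (traceDeviation A))) ∂ν ≤ 0 := by
  have : ProperSpace (Matrix (ι × κ) (ι × κ) ℂ) := FiniteDimensional.proper ℝ _
  have hint (x y : ι × κ) :
      Integrable (loopIntegrand h x y (Matrix.single x y (1 : ℂ))) ν :=
    (continuous_loopIntegrand hh x y _).integrable_of_ae_norm_le hK
  have hsum : Integrable (fun A => ∑ x, ∑ y, loopIntegrand h x y (Matrix.single x y (1 : ℂ)) A) ν :=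
    integrable_finsetSum _ fun x _ => integrable_finsetSum _ fun y _ => hint x y
  have hzero : ∫ A, ∑ x, ∑ y, loopIntegrand h x y (Matrix.single x y (1 : ℂ)) A ∂ν = 0 := by
    rw [integral_finsetSum _ fun x _ => integrable_finsetSum _ fun y _ => hint x y]
    refine Finset.sum_eq_zero fun x _ => ?_
    rw [integral_finsetSum _ fun y _ => hint x y]
    exact Finset.sum_eq_zero fun y _ => integral_loopIntegrand_eq_zero hν hH hK hh x y _
  have hq : Continuous (traceDeviation (ι := ι) (κ := κ)) :=
    (contDiff_traceDeviation (k := 0)).continuous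
  have hc := hh.continuous
  have hd := hh.continuous_deriv_one
  calc _ ≤ ∫ A, (∑ x, ∑ y, loopIntegrand h x y (Matrix.single x y (1 : ℂ)) A).re ∂ν := by
        refine integral_mono_ae ?_ hsum.re ?_
        · exact Continuous.integrable_of_ae_norm_le hK (by fun_prop)
        · filter_upwards [hH, hK, hL] with A hA hAK hAL
          exact le_re_sum_loopIntegrand_single hA hAK hAL (h0 _) (h0' _)
    _ = (∫ A, ∑ x, ∑ y, loopIntegrand h x y (Matrix.single x y (1 : ℂ)) A ∂ν).re :=
        integral_re hsum
    _ = 0 := by rw [hzero, Complex.zero_re]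

/-- The test function vanishes below `c`. Hypothesis `hc` lets `N c / 2` absorb the error from `L`,
and where the test function is nonzero `q ≤ 2 (q - c / 2)`, which turns the constant 4 into 8 and
makes both sides integrals of the same shape. -/
theorem integral_posPart_pow_succ_le {ν : Measure (Matrix (ι × κ) (ι × κ) ℂ)} [IsFiniteMeasure ν]
    (hν : ∀ U ∈ Matrix.unitaryGroup (ι × κ) ℂ, ν.map (fun A => U * A * star U) = ν)
    (hH : ∀ᵐ A ∂ν, A.IsHermitian) {K L c : ℝ} (hK : ∀ᵐ A ∂ν, ‖A‖ ≤ K)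
    (hL : ∀ᵐ A ∂ν, (A * A).trace.re ≤ L)
    (hc : Fintype.card ι / Fintype.card κ * L ≤ Fintype.card (ι × κ) * (c / 2)) (k : ℕ) :
    ∫ A, (traceDeviation A - c / 2) * max (traceDeviation A - c) 0 ^ (k + 2) ∂ν ≤
      8 * K ^ 2 / Fintype.card (ι × κ) * (k + 2) *
        ∫ A, (traceDeviation A - c / 2) * max (traceDeviation A - c) 0 ^ (k + 1) ∂ν := by
  have : ProperSpace (Matrix (ι × κ) (ι × κ) ℂ) := FiniteDimensional.proper ℝ _
  have hN : 0 < (Fintype.card (ι × κ) : ℝ) := Nat.cast_pos.2 Fintype.card_pos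
  have hq : Continuous (traceDeviation (ι := ι) (κ := κ)) :=
    (contDiff_traceDeviation (k := 0)).continuous
  have hint (j : ℕ) : Integrable (fun A : Matrix (ι × κ) (ι × κ) ℂ =>
      (traceDeviation A - c / 2) * max (traceDeviation A - c) 0 ^ j) ν :=
    Continuous.integrable_of_ae_norm_le hK (by fun_prop)
  have h1 := integral_loop_le_zero hν hH hK hL (contDiff_posPart_sub_pow c k)
    (fun x => by positivity) (fun x => by rw [deriv_posPart_sub_pow]; positivity)
  have h2 : ∫ A, (Fintype.card (ι × κ) * ((traceDeviation A - c / 2) *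
      max (traceDeviation A - c) 0 ^ (k + 2)) - 8 * K ^ 2 * (k + 2) *
        ((traceDeviation A - c / 2) * max (traceDeviation A - c) 0 ^ (k + 1))) ∂ν ≤ 0 := by
    refine (integral_mono_ae (((hint _).const_mul _).sub ((hint _).const_mul _)) ?_ ?_).trans h1
    · refine Continuous.integrable_of_ae_norm_le hK ?_
      rw [deriv_posPart_sub_pow]
      fun_prop
    · refine Eventually.of_forall fun A => ?_
      simp only [deriv_posPart_sub_pow, Pi.sub_apply]
      set q := traceDeviation A
      have hX : 0 ≤ max (q - c) 0 := le_max_right _ _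
      have e1 : Fintype.card (ι × κ) * ((q - c / 2) * max (q - c) 0 ^ (k + 2)) ≤
          (Fintype.card (ι × κ) * q - Fintype.card ι / Fintype.card κ * L) *
            max (q - c) 0 ^ (k + 2) := by
        rw [← mul_assoc]
        refine mul_le_mul_of_nonneg_right ?_ (pow_nonneg hX _)
        rw [mul_sub]
        linarith
      have e2 : q * max (q - c) 0 ^ (k + 1) ≤ 2 * ((q - c / 2) * max (q - c) 0 ^ (k + 1)) := by
        rcases le_total q c with h | h
        · rw [max_eq_right (by linarith), zero_pow (by omega)]
          simp
        · rw [← mul_assoc]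
          exact mul_le_mul_of_nonneg_right (by linarith) (pow_nonneg hX _)
      have e3 := mul_le_mul_of_nonneg_left e2 (show 0 ≤ 4 * K ^ 2 * ((k : ℝ) + 2) by positivity)
      linarith
  rw [integral_sub ((hint _).const_mul _) ((hint _).const_mul _), integral_const_mul,
    integral_const_mul] at h2
  rw [div_mul_eq_mul_div, div_mul_eq_mul_div, le_div_iff₀ hN]
  linarith

theorem pow_five_mul_measureReal_traceDeviation_le {ν : Measure (Matrix (ι × κ) (ι × κ) ℂ)}
    [IsFiniteMeasure ν]
    (hν : ∀ U ∈ Matrix.unitaryGroup (ι × κ) ℂ, ν.map (fun A => U * A * star U) = ν)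
    (hH : ∀ᵐ A ∂ν, A.IsHermitian) {K L c : ℝ} (hK : ∀ᵐ A ∂ν, ‖A‖ ≤ K)
    (hL : ∀ᵐ A ∂ν, (A * A).trace.re ≤ L) (hc0 : 0 ≤ c)
    (hc : Fintype.card ι / Fintype.card κ * L ≤ Fintype.card (ι × κ) * (c / 2)) :
    c ^ 5 * ν.real {A | 2 * c ≤ traceDeviation A} ≤
      12288 * (K ^ 6 / (Fintype.card (ι × κ) : ℝ) ^ 3) * (ν.real Set.univ * L ^ 2) := by
  have : ProperSpace (Matrix (ι × κ) (ι × κ) ℂ) := FiniteDimensional.proper ℝ _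
  have hN : 0 < (Fintype.card (ι × κ) : ℝ) := Nat.cast_pos.2 Fintype.card_pos
  have hq : Continuous (traceDeviation (ι := ι) (κ := κ)) :=
    (contDiff_traceDeviation (k := 0)).continuous
  set a : ℕ → ℝ := fun k =>
    ∫ A, (traceDeviation A - c / 2) * max (traceDeviation A - c) 0 ^ k ∂ν with ha
  have hint (j : ℕ) : Integrable (fun A : Matrix (ι × κ) (ι × κ) ℂ =>
      (traceDeviation A - c / 2) * max (traceDeviation A - c) 0 ^ j) ν :=
    Continuous.integrable_of_ae_norm_le hK (by fun_prop)
  have hrec (k : ℕ) : a (k + 2) ≤ 8 * K ^ 2 / Fintype.card (ι × κ) * (k + 2) * a (k + 1) :=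
    integral_posPart_pow_succ_le hν hH hK hL hc k
  have h1 : a 1 ≤ ν.real Set.univ * L ^ 2 := by
    have : ∫ _, L ^ 2 ∂ν = ν.real Set.univ * L ^ 2 := by simp
    rw [← this]
    refine integral_mono_ae (hint 1) (integrable_const _) ?_
    filter_upwards [hH, hL] with A hA hAL
    have e0 := traceDeviation_nonneg hA
    have e1 := (traceDeviation_le hA).trans hAL
    simp only [pow_one]
    rcases le_total (traceDeviation A) c with h | h
    · rw [max_eq_right (by linarith), mul_zero]
      positivity
    · rw [max_eq_left (by linarith), sq]
      exact mul_le_mul (by linarith) (by linarith) (by linarith) (by linarith)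
  -- Three steps of the recursion from `a 1`: `12288 = 8³ · 4 · 3 · 2`.
  have h4 : a 4 ≤ 12288 * (K ^ 6 / (Fintype.card (ι × κ) : ℝ) ^ 3) * (ν.real Set.univ * L ^ 2) := by
    set δ := 8 * K ^ 2 / (Fintype.card (ι × κ) : ℝ) with hδ
    have hδ0 : 0 ≤ δ := by positivity
    calc a 4 ≤ δ * ((2 : ℕ) + 2) * a 3 := hrec 2
      _ ≤ δ * ((2 : ℕ) + 2) * (δ * ((1 : ℕ) + 2) * a 2) :=
        mul_le_mul_of_nonneg_left (hrec 1) (by positivity)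
      _ ≤ δ * ((2 : ℕ) + 2) * (δ * ((1 : ℕ) + 2) * (δ * ((0 : ℕ) + 2) * a 1)) :=
        mul_le_mul_of_nonneg_left (mul_le_mul_of_nonneg_left (hrec 0) (by positivity))
          (by positivity)
      _ ≤ δ * ((2 : ℕ) + 2) * (δ * ((1 : ℕ) + 2) * (δ * ((0 : ℕ) + 2) *
          (ν.real Set.univ * L ^ 2))) := by gcongr
      _ = _ := by
        rw [hδ]
        push_cast
        ring
  refine le_trans ?_ h4
  have h5 := mul_meas_ge_le_integral_of_nonneg (μ := ν) (Eventually.of_forall fun A => ?_) (hint 4)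
    (c ^ 5)
  · refine le_trans ?_ h5
    refine mul_le_mul_of_nonneg_left (measureReal_mono fun A hA => ?_) (by positivity)
    have hA' : 2 * c ≤ traceDeviation A := hA
    -- On the event `2 * c ≤ q`, both `q - c / 2` and the positive part of `q - c` are at least `c`.
    calc c ^ 5 = c * c ^ 4 := by ring
      _ ≤ (traceDeviation A - c / 2) * max (traceDeviation A - c) 0 ^ 4 := by
        refine mul_le_mul (by linarith) (pow_le_pow_left₀ hc0 ?_ 4) (by positivity) (by linarith)
        exact le_max_of_le_left (by linarith)
  · simp only [Pi.zero_apply]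
    rcases le_total (traceDeviation A) c with h | h
    · rw [max_eq_right (by linarith)]
      simp
    · exact mul_nonneg (by linarith) (by positivity)

end TailBound

/-! ### Truncation to a conjugation-invariant set. -/

section BoundedMoments

variable {n : Type*} [Fintype n] [DecidableEq n]

/-- The Hermitian matrices whose normalized second and sixth moments are at most `s` and `t`. -/
def boundedMoments (n : Type*) [Fintype n] [DecidableEq n] (s t : ℝ) : Set (Matrix n n ℂ) :=
  {A | A.IsHermitian ∧ (A * A).trace.re ≤ Fintype.card n * s ∧
    (A ^ 6).trace.re ≤ Fintype.card n * t}

theorem measurableSet_boundedMoments (s t : ℝ) : MeasurableSet (boundedMoments n s t) := by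
  have h1 : IsClosed {A : Matrix n n ℂ | A.IsHermitian} :=
    isClosed_eq (by fun_prop) continuous_id
  have h2 : IsClosed {A : Matrix n n ℂ | (A * A).trace.re ≤ Fintype.card n * s} :=
    isClosed_le (Complex.continuous_re.comp (continuous_id.mul continuous_id).matrix_trace)
      continuous_const
  have h3 : IsClosed {A : Matrix n n ℂ | (A ^ 6).trace.re ≤ Fintype.card n * t} :=
    isClosed_le (Complex.continuous_re.comp (continuous_id.pow 6).matrix_trace) continuous_const
  exact (h1.inter (h2.inter h3)).measurableSet

theorem unitary_conj_mem_boundedMoments_iff {U : Matrix n n ℂ} (hU : U ∈ Matrix.unitaryGroup n ℂ)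
    {s t : ℝ} (A : Matrix n n ℂ) :
    U * A * star U ∈ boundedMoments n s t ↔ A ∈ boundedMoments n s t := by
  have h {V : Matrix n n ℂ} (hV : V ∈ Matrix.unitaryGroup n ℂ) {B : Matrix n n ℂ}
      (hB : B ∈ boundedMoments n s t) : V * B * star V ∈ boundedMoments n s t := by
    have hVV : star V * V = 1 := Matrix.mem_unitaryGroup_iff'.1 hV
    have hpow (k : ℕ) : (V * B * star V) ^ (k + 1) = V * B ^ (k + 1) * star V := by
      induction k with
      | zero => simp
      | succ k ih =>
        rw [pow_succ, ih, pow_succ B (k + 1)]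
        simp only [mul_assoc]
        rw [← mul_assoc (star V) V, hVV, one_mul]
    have htr (k : ℕ) : ((V * B * star V) ^ (k + 1)).trace = (B ^ (k + 1)).trace := by
      rw [hpow, Matrix.trace_mul_comm, ← mul_assoc, hVV, one_mul]
    refine ⟨?_, ?_, ?_⟩
    · rw [Matrix.star_eq_conjTranspose]
      exact Matrix.isHermitian_mul_mul_conjTranspose V hB.1
    · rw [← sq, htr 1, sq]
      exact hB.2.1
    · rw [htr 5]
      exact hB.2.2
  refine ⟨fun hA => ?_, h hU⟩
  have h1 := h (Unitary.star_mem hU) hA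
  have hUU : star U * U = 1 := Matrix.mem_unitaryGroup_iff'.1 hU
  rwa [star_star, show star U * (U * A * star U) * U = (star U * U) * A * (star U * U) by
    simp only [mul_assoc], hUU, one_mul, mul_one] at h1

/-- Truncation must not destroy invariance: the moments depend only on the spectrum, so restricting
to them keeps the law invariant while bounding its support. The restricted measure is left
unnormalized. -/
theorem IsUnitarilyInvariant.map_restrict_boundedMoments {Ω : Type*} [MeasurableSpace Ω]
    {P : Measure Ω} {X : Ω → Matrix n n ℂ} (hX : Measurable X) (hinv : IsUnitarilyInvariant P X)
    (s t : ℝ) {U : Matrix n n ℂ} (hU : U ∈ Matrix.unitaryGroup n ℂ) :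
    ((P.map X).restrict (boundedMoments n s t)).map (fun A => U * A * star U) =
      (P.map X).restrict (boundedMoments n s t) := by
  have hc : Measurable fun A : Matrix n n ℂ => U * A * star U :=
    Continuous.measurable (by fun_prop)
  have hpre : (fun A : Matrix n n ℂ => U * A * star U) ⁻¹' boundedMoments n s t =
      boundedMoments n s t := Set.ext fun A => unitary_conj_mem_boundedMoments_iff hU A
  conv_lhs => rw [← hpre]
  rw [← Measure.restrict_map hc (measurableSet_boundedMoments s t), Measure.map_map hc hX]
  exact congrArg (fun ν => Measure.restrict ν _) (hinv U hU)

end BoundedMoments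

/-! ### From tail bounds to almost sure statements. -/

section AlmostSure

theorem IsUnitarilyInvariant.measureReal_traceDeviation_le {ι κ : Type*} [Fintype ι] [Fintype κ]
    [DecidableEq ι] [DecidableEq κ] [Nonempty ι] [Nonempty κ] {Ω : Type*} [MeasurableSpace Ω]
    {P : Measure Ω} [IsProbabilityMeasure P] {X : Ω → Matrix (ι × κ) (ι × κ) ℂ}
    (hX : Measurable X) (hinv : IsUnitarilyInvariant P X) {s t c : ℝ} (ht : 0 ≤ t) (hc0 : 0 ≤ c)
    (hc : Fintype.card ι / Fintype.card κ * s ≤ c / 2) :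
    c ^ 5 * P.real {ω | X ω ∈ boundedMoments (ι × κ) s t ∧ 2 * c ≤ traceDeviation (X ω)} ≤
      12288 * t * s ^ 2 := by
  have hN : 0 < (Fintype.card (ι × κ) : ℝ) := Nat.cast_pos.2 Fintype.card_pos
  have hG := measurableSet_boundedMoments (n := ι × κ) s t
  have : IsProbabilityMeasure (P.map X) := Measure.isProbabilityMeasure_map hX.aemeasurable
  set ν := (P.map X).restrict (boundedMoments (ι × κ) s t) with hν
  have hmem : ∀ᵐ A ∂ν, A ∈ boundedMoments (ι × κ) s t := ae_restrict_mem hG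
  -- `K` is chosen with `K⁶ = N t`, so with `L = N s` all powers of `N` cancel in the final bound.
  set K := (Fintype.card (ι × κ) * t) ^ ((6 : ℕ) : ℝ)⁻¹ with hKdef
  have hK6 : K ^ 6 = Fintype.card (ι × κ) * t :=
    Real.rpow_inv_natCast_pow (by positivity) (by norm_num)
  have hK : ∀ᵐ A ∂ν, ‖A‖ ≤ K := by
    filter_upwards [hmem] with A hA
    refine le_of_pow_le_pow_left₀ (n := 6) (by norm_num) (by positivity) ?_
    rw [hK6]
    exact hA.1.norm_pow_six_le.trans hA.2.2
  have h := pow_five_mul_measureReal_traceDeviation_le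
    (fun U hU => hinv.map_restrict_boundedMoments hX s t hU)
    (hmem.mono fun A hA => hA.1) hK (hmem.mono fun A hA => hA.2.1) hc0 (by
      rw [mul_left_comm]
      exact mul_le_mul_of_nonneg_left hc hN.le)
  have hq : Continuous (traceDeviation (ι := ι) (κ := κ)) :=
    (contDiff_traceDeviation (k := 0)).continuous
  have hS : MeasurableSet {A : Matrix (ι × κ) (ι × κ) ℂ | 2 * c ≤ traceDeviation A} :=
    (isClosed_le continuous_const hq).measurableSet
  have hset : ν.real {A | 2 * c ≤ traceDeviation A} =
      P.real {ω | X ω ∈ boundedMoments (ι × κ) s t ∧ 2 * c ≤ traceDeviation (X ω)} := by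
    rw [hν, measureReal_restrict_apply hS, map_measureReal_apply hX (hS.inter hG)]
    refine congrArg _ (Set.ext fun ω => ?_)
    exact and_comm
  have huniv : ν.real Set.univ ≤ 1 := by
    rw [hν, measureReal_restrict_apply_univ]
    exact measureReal_le_one
  rw [← hset]
  refine h.trans ?_
  rw [hK6]
  calc _ ≤ 12288 * (Fintype.card (ι × κ) * t / (Fintype.card (ι × κ) : ℝ) ^ 3) *
        (1 * (Fintype.card (ι × κ) * s) ^ 2) := by gcongr
    _ = _ := by field_simp

/-- Borel-Cantelli with threshold `c = d₂ ε`. The events include the condition `good d`, so the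
finitely many bad dimensions contribute empty sets. -/
theorem ae_eventually_traceDeviation_lt {Ω : Type*} [MeasurableSpace Ω] (P : Measure Ω)
    [IsProbabilityMeasure P] (d₁ d₂ : ℕ → ℕ)
    (A : ∀ d, Ω → Matrix (Fin (d₁ d) × Fin (d₂ d)) (Fin (d₁ d) × Fin (d₂ d)) ℂ)
    (hA_meas : ∀ d, Measurable (A d))
    (hd₁ : Tendsto d₁ atTop atTop) (hd₂ : Tendsto d₂ atTop atTop)
    (hd : Tendsto (fun d => (d₁ d : ℝ) / (d₂ d : ℝ) ^ 2) atTop (𝓝 0))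
    (hd_sum : Summable fun d => ((d₂ d : ℝ) ^ 4)⁻¹)
    (hA_inv : ∀ d, IsUnitarilyInvariant P (A d)) {s t : ℝ} (ht : 0 ≤ t)
    (hA : ∀ᵐ ω ∂P, ∀ᶠ d in atTop, A d ω ∈ boundedMoments (Fin (d₁ d) × Fin (d₂ d)) s t)
    {ε : ℝ} (hε : 0 < ε) :
    ∀ᵐ ω ∂P, ∀ᶠ d in atTop, traceDeviation (A d ω) < 2 * (d₂ d * ε) := by
  set good : ℕ → Prop := fun d => 1 ≤ d₁ d ∧ 1 ≤ d₂ d ∧ (d₁ d : ℝ) / (d₂ d : ℝ) ^ 2 * s ≤ ε / 2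
    with hgood
  have hev : ∀ᶠ d in atTop, good d := by
    refine (hd₁.eventually_ge_atTop 1).and ((hd₂.eventually_ge_atTop 1).and ?_)
    have h := hd.mul_const s
    rw [zero_mul] at h
    exact h.eventually_le_const (half_pos hε)
  set E : ℕ → Set Ω := fun d => {ω | good d ∧ A d ω ∈ boundedMoments (Fin (d₁ d) × Fin (d₂ d)) s t ∧
    2 * (d₂ d * ε) ≤ traceDeviation (A d ω)} with hE
  have hbound (d : ℕ) : P (E d) ≤ ENNReal.ofReal (12288 * t * s ^ 2 / ε ^ 5 *
      ((d₂ d : ℝ) ^ 4)⁻¹) := by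
    by_cases hg : good d
    · have : Nonempty (Fin (d₁ d)) := ⟨⟨0, hg.1⟩⟩
      have : Nonempty (Fin (d₂ d)) := ⟨⟨0, hg.2.1⟩⟩
      have hn : (1 : ℝ) ≤ d₂ d := by exact_mod_cast hg.2.1
      have h := (hA_inv d).measureReal_traceDeviation_le (hA_meas d) (s := s) (c := d₂ d * ε) ht
        (by positivity) (by
          have h1 := mul_le_mul_of_nonneg_left hg.2.2 (zero_le_one.trans hn)
          rw [Fintype.card_fin, Fintype.card_fin]
          calc (d₁ d : ℝ) / d₂ d * s = d₂ d * ((d₁ d : ℝ) / (d₂ d : ℝ) ^ 2 * s) := by field_simp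
            _ ≤ d₂ d * (ε / 2) := h1
            _ = _ := by ring)
      rw [← ofReal_measureReal]
      refine ENNReal.ofReal_le_ofReal ?_
      have hEd : E d = {ω | A d ω ∈ boundedMoments (Fin (d₁ d) × Fin (d₂ d)) s t ∧
          2 * (d₂ d * ε) ≤ traceDeviation (A d ω)} := by
        ext ω
        simp [hE, hg]
      rw [hEd, div_mul_eq_mul_div, ← div_eq_mul_inv, div_div, le_div_iff₀ (by positivity)]
      refine le_trans ?_ h
      rw [mul_comm]
      refine mul_le_mul_of_nonneg_right ?_ measureReal_nonneg
      rw [mul_pow]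
      refine mul_le_mul_of_nonneg_right ?_ (by positivity)
      -- The tail bound decays like `d₂⁻⁵`; only the fourth power is needed.
      exact pow_le_pow_right₀ hn (by norm_num)
    · have hEd : E d = ∅ := by
        ext ω
        simp [hE, hg]
      rw [hEd, measure_empty]
      exact zero_le
  have hsum : ∑' d, P (E d) ≠ ⊤ := by
    refine ne_top_of_le_ne_top ?_ (ENNReal.tsum_le_tsum hbound)
    exact (hd_sum.mul_left _).tsum_ofReal_ne_top
  filter_upwards [ae_eventually_notMem hsum, hA] with ω h1 h2
  filter_upwards [h1, h2, hev] with d h3 h4 h5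
  by_contra h6
  exact h3 ⟨h5, h4, not_lt.1 h6⟩

theorem HasAlmostSureLimitDistribution.eventually_re_trace_le {Ω : Type*} [MeasurableSpace Ω]
    {n : ℕ → Type*} [∀ d, Fintype (n d)] [∀ d, DecidableEq (n d)] {P : Measure Ω}
    {X : ∀ d, Ω → Matrix (n d) (n d) ℂ} {μ : Measure ℝ}
    (h : HasAlmostSureLimitDistribution P X μ) (hn : ∀ᶠ d in atTop, 0 < Fintype.card (n d))
    {p : ℕ} (hp : 1 ≤ p) :
    ∀ᵐ ω ∂P, ∀ᶠ d in atTop,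
      (X d ω ^ p).trace.re ≤ Fintype.card (n d) * (∫ x, x ^ p ∂μ + 1) := by
  filter_upwards [h p hp] with ω hω
  have h1 := (Complex.continuous_re.tendsto _).comp hω
  rw [Complex.ofReal_re] at h1
  filter_upwards [h1.eventually_le_const (lt_add_one _), hn] with d h2 h3
  have h4 : (normalizedTrace (X d ω ^ p)).re = (X d ω ^ p).trace.re / Fintype.card (n d) := by
    rw [normalizedTrace, Complex.div_natCast_re]
  rw [Function.comp_apply, h4, div_le_iff₀ (by exact_mod_cast h3)] at h2
  linarith

end AlmostSure

theorem mainTheorem6 {Ω : Type*} [MeasurableSpace Ω] (P : Measure Ω) [IsProbabilityMeasure P]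
    (d₁ d₂ : ℕ → ℕ)
    (A : ∀ d, Ω → Matrix (Fin (d₁ d) × Fin (d₂ d)) (Fin (d₁ d) × Fin (d₂ d)) ℂ)
    (hA_meas : ∀ d, Measurable (A d))
    (hA_herm : ∀ d, ∀ᵐ ω ∂P, (A d ω).IsHermitian)
    (hd₁ : Tendsto d₁ atTop atTop) (hd₂ : Tendsto d₂ atTop atTop)
    (hd : Tendsto (fun d => (d₁ d : ℝ) / (d₂ d : ℝ) ^ 2) atTop (𝓝 0))
    (hd_sum : Summable fun d => ((d₂ d : ℝ) ^ 4)⁻¹)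
    (hA_inv : ∀ d, IsUnitarilyInvariant P (A d))
    (μ : Measure ℝ) [IsProbabilityMeasure μ] (hμ : IsCompact μ.support)
    (hA_lim : HasAlmostSureLimitDistribution P A μ) :
    ∀ᵐ ω ∂P, Tendsto
      (fun d => ‖((d₂ d : ℂ)⁻¹ • partialTraceSnd (A d ω)
        - ((∫ x, x ∂μ : ℝ) : ℂ) • (1 : Matrix (Fin (d₁ d)) (Fin (d₁ d)) ℂ))‖)
      atTop (𝓝 0) := by
  have hpos : ∀ᶠ d in atTop, 1 ≤ d₁ d ∧ 1 ≤ d₂ d :=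
    (hd₁.eventually_ge_atTop 1).and (hd₂.eventually_ge_atTop 1)
  have hcard : ∀ᶠ d in atTop, 0 < Fintype.card (Fin (d₁ d) × Fin (d₂ d)) := by
    filter_upwards [hpos] with d h
    rw [Fintype.card_prod, Fintype.card_fin, Fintype.card_fin]
    exact Nat.mul_pos h.1 h.2
  have hherm : ∀ᵐ ω ∂P, ∀ d, (A d ω).IsHermitian := ae_all_iff.2 hA_herm
  have hbdd : ∀ᵐ ω ∂P, ∀ᶠ d in atTop, A d ω ∈
      boundedMoments (Fin (d₁ d) × Fin (d₂ d)) (∫ x, x ^ 2 ∂μ + 1) (∫ x, x ^ 6 ∂μ + 1) := by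
    filter_upwards [hherm, hA_lim.eventually_re_trace_le hcard one_le_two,
      hA_lim.eventually_re_trace_le hcard (show 1 ≤ 6 by norm_num)] with ω h1 h2 h3
    filter_upwards [h2, h3] with d h4 h5
    exact ⟨h1 d, by rwa [← sq], h5⟩
  -- Thresholds `1 / (k + 1)` suffice, so only countably many null sets are discarded.
  have hdev : ∀ᵐ ω ∂P, ∀ k : ℕ, ∀ᶠ d in atTop,
      traceDeviation (A d ω) < 2 * (d₂ d * (1 / ((k : ℝ) + 1))) :=
    ae_all_iff.2 fun k => ae_eventually_traceDeviation_lt P d₁ d₂ A hA_meas hd₁ hd₂ hd hd_sum hA_inv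
      (add_nonneg (integral_nonneg fun x => Even.pow_nonneg (by decide) x) zero_le_one)
      hbdd Nat.one_div_pos_of_nat
  filter_upwards [hherm, hdev, hA_lim 1 le_rfl] with ω hH hlt h1
  simp only [pow_one] at h1
  have hb : Tendsto (fun d => ‖normalizedTrace (A d ω) - ((∫ x, x ∂μ : ℝ) : ℂ)‖) atTop (𝓝 0) :=
    tendsto_iff_norm_sub_tendsto_zero.1 h1
  have hB : Tendsto (fun d => ‖((d₂ d : ℂ)⁻¹ • partialTraceSnd (A d ω)
      - normalizedTrace (A d ω) • (1 : Matrix (Fin (d₁ d)) (Fin (d₁ d)) ℂ))‖) atTop (𝓝 0) := by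
    refine tendsto_order.2 ⟨fun a ha => Eventually.of_forall fun d => ha.trans_le (norm_nonneg _),
      fun η hη => ?_⟩
    -- The squared norm will be below `2 / (k + 1)`, after cancelling `d₂`; hence the choice `η² /
    -- 2`.
    obtain ⟨k, hk⟩ := exists_nat_one_div_lt (show 0 < η ^ 2 / 2 by positivity)
    filter_upwards [hlt k, hpos] with d h2 h3
    have : Nonempty (Fin (d₁ d)) := ⟨⟨0, h3.1⟩⟩
    have : Nonempty (Fin (d₂ d)) := ⟨⟨0, h3.2⟩⟩
    have hn : (0 : ℝ) < d₂ d := by exact_mod_cast h3.2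
    have h4 := (card_mul_norm_sq_le_traceDeviation (hH d)).trans_lt h2
    rw [Fintype.card_fin, mul_left_comm] at h4
    have h5 := lt_of_mul_lt_mul_left h4 hn.le
    exact lt_of_pow_lt_pow_left₀ 2 hη.le (by linarith)
  refine squeeze_zero' (Eventually.of_forall fun d => norm_nonneg _) ?_
    (by simpa using hB.add hb)
  filter_upwards [hpos] with d h3
  have : Nonempty (Fin (d₁ d)) := ⟨⟨0, h3.1⟩⟩
  have h4 : ‖(normalizedTrace (A d ω) - ((∫ x, x ∂μ : ℝ) : ℂ)) •
      (1 : Matrix (Fin (d₁ d)) (Fin (d₁ d)) ℂ)‖ =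
      ‖normalizedTrace (A d ω) - ((∫ x, x ∂μ : ℝ) : ℂ)‖ := by
    rw [norm_smul, CStarRing.norm_one, mul_one]
  rw [← h4]
  refine le_trans (le_of_eq (congrArg _ ?_)) (norm_add_le _ _)
  rw [sub_smul]
  abel
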